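/- **Setting.** Let $D=(V,A)$ be a finite acyclic digraph, $b\colon V\to\mathbb{R}$, and let $x\in\mathbb{R}^A_{\ge 0}$ be a $b$-transshipment, i.e. outflow minus inflow of $x$ equals $b(v)$ at every $v\in V$. Let $S^+=\{v: b(v)>0\}$ (sources) and $S^-=\{v: b(v)<0\}$ (sinks). **Modified DGG Algorithm.** Add a super-source $s^*$ and, for every $s\in S^+$, a dummy arc $(s^*,s)$ with flow $b(s)$. Together with $x$ this is the initial flow $y$. At any time the current network consists of the arcs $a$ with $y_a>0$ (arcs without flow are deleted). Every sink $t\in S^-$ starts at vertex $t$ with demand $d_t=|b(t)|$. *Moving* a (sub-)sink with demand $d$ located at $v$ backward along an arc $a=(u,v)$ means placing it at $u$ and decreasing $y_a$ by $d$. When a (sub-)sink of $t$ with demand $d$ reaches $s^*$ through the dummy arc $(s^*,s)$, the traversed $s$–$t$ path is output with flow value $d$. All choices left open below are arbitrary. *Preliminary phase.* As long as possible, move a sink along an arc $a$ entering its current vertex with $y_a$ at least its demand. *Iterations.* While some (sub-)sink has not reached $s^*$, do the following. Call a vertex a *funnel* vertex if its out-degree is at most one, and a *junction* if its out-degree is zero.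 Label an arc $(u,v)$ *singular* if $v$ and all vertices reachable from $v$ are funnel vertices; the labels are kept throughout the iteration. From an arbitrary vertex, follow outgoing arcs (a forward path) until a junction $w$ is reached, say along the arc $a'$. From $w$, search backward along singular arcs, ignoring $a'$. If the search reaches a non-funnel vertex $v\ne s^*$, take a backward path from $w$ to $v$ and continue from $v$ with a forward path that starts with an outgoing arc different from the one just traversed, and so on, until a vertex is revisited; this closes an alternating cycle. * (a) If an alternating cycle avoiding $s^*$ (a *nice* cycle) is found, decrease $y$ on its forward arcs and increase $y$ on its backward arcs by $\varepsilon$. Here $\varepsilon$ is the minimum of all $y_a$ with $a$ a forward arc of the cycle and all $d-y_a$ with $a$ a backward arc of the cycle and $d>y_a$ the demand of a (sub-)sink at the head of $a$. * (b) If the backward search from a junction $w$ (reached along $a'$) finds no non-funnel vertex other than $s^*$, the explored digraph is called the *singular digraph* rooted at $w$; without $s^*$ it is an in-tree with root $w$. Choose a (sub-)sink $t$ at $w$ with $d_t>y_{a'}$ and repeat the following. Choose a source $s$ that is a leaf of the remaining in-tree (its only remaining incoming arc in the singular digraph is the dummy arc $(s^*,s)$) and follow the outgoing arcs from $s$ to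 the first vertex containing a (sub-)sink (possibly $s$ itself). Choose a (sub-)sink $t'$ there, where $t'=t$ is allowed only if no other (sub-)sink is at $w$. If $d_{t'}\le y_{(s^*,s)}$, move all of $t'$ backward along this path and the dummy arc to $s^*$. Otherwise split $t'$ into two sub-sinks with demands $y_{(s^*,s)}$ and $d_{t'}-y_{(s^*,s)}$; move the first one to $s^*$ in this way and leave the second one in place. Stop when no flow is left on the singular digraph and only a sub-sink of $t$ remains at its vertices (at $w$). Then move this sub-sink along $a'$. In both cases, afterwards, as long as possible, move (sub-)sinks by the DGG moving rules: along an entering singular arc carrying exactly the demand of the (sub-)sink or, if there is no such arc, along an entering non-singular arc carrying at least its demand. **Theorem.** Consider any output of the Modified DGG Algorithm, that is, the family of source–sink paths with flow values output by a terminating run. Let $G$ be the bipartite graph on $S^+\cup S^-$ in which $s\in S^+$ and $t\in S^-$ are adjacent if and only if the output routes flow along an $s$–$t$ path. Then $G$ is acyclic (a forest). Consequently, if $b\neq 0$, then $G$ has at most $|S^+|+|S^-|-1$ edges and the output uses at most $|S^+|+|S^-|-1$ paths. -/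

import Mathlib

/-!  Unsplittable transshipments and the Modified Dinitz–Garg–Goemans (DGG) Algorithm.

The algorithm makes arbitrary choices (which sink to move, which cycle to use, and so on).  It is
modelled as a nondeterministic transition system, so that an output is anything that some sequence
of admissible choices produces. -/

namespace ModDGG

open Classical

noncomputable section

/-! ### Transshipments, path flows, and the bipartite graph -/

/-- The sources `S⁺` of a balance function. -/
def sources {V : Type*} (b : V → ℝ) : Set V := {v | 0 < b v}

/-- The sinks `S⁻` of a balance function. -/
def sinks {V : Type*} (b : V → ℝ) : Set V := {v | b v < 0}

/-- A digraph is acyclic if it has no directed closed walk of positive length. -/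
def DigraphAcyclic {V : Type*} (D : Digraph V) : Prop :=
  ∀ v, ¬ Relation.TransGen D.Adj v v

/-- `x` is a `b`-transshipment in `D`: a nonnegative vector on the arcs of `D` (extended by zero to
all pairs of vertices) with outflow minus inflow equal to `b v` at every vertex `v`. -/
structure IsTransshipment {V : Type*} [Fintype V] (D : Digraph V) (b : V → ℝ)
    (x : V → V → ℝ) : Prop where
  nonneg : ∀ u v, 0 ≤ x u v
  support : ∀ u v, ¬ D.Adj u v → x u v = 0
  balance : ∀ v, ∑ w, x v w - ∑ u, x u v = b v

/-- A path, given by its list of vertices from start to end, with the amount of flow routed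
along it. -/
structure PathFlow (V : Type*) where
  vertices : List V
  amount : ℝ

/-- The path flows in `P` route flow along some path from `s` to `t`. -/
def RoutesFlow {V : Type*} (P : List (PathFlow V)) (s t : V) : Prop :=
  ∃ p ∈ P, 0 < p.amount ∧ p.vertices.head? = some s ∧ p.vertices.getLast? = some t

/-- The bipartite graph with vertex set `S⁺ ∪ S⁻` in which a source `s` and a sink `t` are adjacent
if and only if flow is routed along an `s`–`t` path. -/
def bipartiteGraph {V : Type*} (b : V → ℝ) (P : List (PathFlow V)) :
    SimpleGraph ↥(sources b ∪ sinks b) :=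
  SimpleGraph.fromRel fun s t => (s : V) ∈ sources b ∧ (t : V) ∈ sinks b ∧ RoutesFlow P s t

/-! ### States

The vertices of the network with super-source are `Option V`, where `none` is the super-source
`s*`.  The current network consists of the arcs `(u, v)` with `0 < y u v`: an arc without flow
counts as deleted. -/

/-- A state of the algorithm.  At any time every original sink `t` has at most one sub-sink that has
not reached the super-source yet: parts that are split off are moved to the super-source at once. -/
structure State {V : Type*} (b : V → ℝ) where
  /-- the current flow -/
  y : Option V → Option V → ℝ
  /-- the current vertex of the (sub-)sink of `t`; it is `none` (that is, `s*`) once all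
  demand of `t` has been moved to the super-source -/
  loc : ↥(sinks b) → Option V
  /-- the demand of the (sub-)sink of `t` (of no meaning once `loc t = none`) -/
  dem : ↥(sinks b) → ℝ
  /-- the path in `D` from the current vertex of the (sub-)sink to `t` along which
  it has been moved backward -/
  trail : ↥(sinks b) → List V
  /-- the paths, with flow values, of the (sub-)sinks that have reached the super-source -/
  out : List (PathFlow V)

variable {V : Type*} {b : V → ℝ}

/-- The initial flow: `x` on the arcs of `D`, and `b s` on the dummy arc `(s*, s)` of each
source `s`. -/
def initFlow (b : V → ℝ) (x : V → V → ℝ) : Option V → Option V → ℝ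
  | some u, some v => x u v
  | none, some s => if s ∈ sources b then b s else 0
  | _, none => 0

/-- The initial state: each sink `t` is at `t` and has demand `|b t|`. -/
def init (b : V → ℝ) (x : V → V → ℝ) : State b where
  y := initFlow b x
  loc t := some t
  dem t := |b t|
  trail t := [(t : V)]
  out := []

/-- Move the (sub-)sink `τ` backward from its current vertex `v` along the arc `(u, v)`, decreasing
the flow on this arc by the demand of `τ`.  If `u = s*`, the path of `τ` is complete. -/
def move (σ : State b) (τ : ↥(sinks b)) (u : Option V) : State b where
  y p q := if p = u ∧ q = σ.loc τ then σ.y p q - σ.dem τ else σ.y p q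
  loc := Function.update σ.loc τ u
  dem := σ.dem
  trail :=
    match u with
    | none => σ.trail
    | some u' => Function.update σ.trail τ (u' :: σ.trail τ)
  out :=
    match u with
    | none => ⟨σ.trail τ, σ.dem τ⟩ :: σ.out
    | some _ => σ.out

/-- Apply steps of the relation `R` until no further step is possible. -/
def RunToEnd {α : Type*} (R : α → α → Prop) (σ σ' : α) : Prop :=
  Relation.ReflTransGen R σ σ' ∧ ∀ σ'', ¬ R σ' σ''

/-- A step of the preliminary phase: a sink moves backward along an arc carrying at least its
demand. -/
def PrelimStep (σ σ' : State b) : Prop :=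
  ∃ (τ : ↥(sinks b)) (v : V) (u : Option V),
    σ.loc τ = some v ∧ 0 < σ.y u (some v) ∧ σ.dem τ ≤ σ.y u (some v) ∧ σ' = move σ τ u

/-! ### Singular arcs, funnel vertices, junction vertices -/

/-- A funnel vertex: at most one outgoing arc in the current network. -/
def Funnel (y : Option V → Option V → ℝ) (u : Option V) : Prop :=
  {v | 0 < y u v}.Subsingleton

/-- A junction vertex: no outgoing arc in the current network. -/
def Junction (y : Option V → Option V → ℝ) (w : Option V) : Prop :=
  ∀ v, ¬ 0 < y w v

/-- The arc `(u, v)` of the current network is singular: `v` and all vertices reachable from `v`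
have out-degree at most one. -/
def Singular (y : Option V → Option V → ℝ) (u v : Option V) : Prop :=
  0 < y u v ∧ ∀ z, Relation.ReflTransGen (fun p q => 0 < y p q) v z → Funnel y z

/-- A move of a (sub-)sink by the DGG moving rules, where `sing` is the labelling of the singular
arcs fixed at the beginning of the iteration: along a singular arc carrying exactly its demand, or,
if there is no such arc, along a non-singular arc carrying at least its demand. -/
def DGGMove (sing : Option V → Option V → Prop) (σ σ' : State b) : Prop :=
  ∃ (τ : ↥(sinks b)) (v : V) (u : Option V),
    σ.loc τ = some v ∧ 0 < σ.y u (some v) ∧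
    ((sing u (some v) ∧ σ.y u (some v) = σ.dem τ) ∨
      (¬ sing u (some v) ∧ σ.dem τ ≤ σ.y u (some v) ∧
        ∀ u', sing u' (some v) → σ.y u' (some v) ≠ σ.dem τ)) ∧
    σ' = move σ τ u

/-! ### Iterations with a nice alternating cycle -/

/-- The walk `v 0, v 1, …, v n` traversed in the search for an alternating cycle.  Step `i` leads
from `v i` to `v (i + 1)`, along the arc `(v i, v (i + 1))` if `fwd i`, and otherwise backward along
the singular arc `(v (i + 1), v i)`.  Forward paths end at junction vertices and are followed by a
backward path that starts with another incoming arc; backward paths end at non-funnel vertices and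
are followed by a forward path that starts with another outgoing arc.  (Interior vertices of
backward paths are heads of singular arcs, so they are funnel vertices.) -/
structure IsSearchWalk (y : Option V → Option V → ℝ) (v : ℕ → Option V) (fwd : ℕ → Prop)
    (n : ℕ) : Prop where
  start : fwd 0
  forward : ∀ i < n, fwd i → 0 < y (v i) (v (i + 1))
  backward : ∀ i < n, ¬ fwd i → Singular y (v (i + 1)) (v i)
  forward_backward : ∀ i, i + 1 < n → fwd i → ¬ fwd (i + 1) →
    Junction y (v (i + 1)) ∧ v (i + 2) ≠ v i
  backward_forward : ∀ i, i + 1 < n → ¬ fwd i → fwd (i + 1) →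
    ¬ Funnel y (v (i + 1)) ∧ v (i + 2) ≠ v i

/-- The search walk stops as soon as a vertex is revisited, `v n = v j`; the vertices
`v j, …, v n` form an alternating cycle, which is nice if it does not contain the super-source. -/
structure IsNiceCycle (y : Option V → Option V → ℝ) (v : ℕ → Option V) (fwd : ℕ → Prop)
    (j n : ℕ) : Prop where
  walk : IsSearchWalk y v fwd n
  lt : j < n
  closed : v n = v j
  distinct : ∀ i < n, ∀ k < n, v i = v k → i = k
  nice : ∀ i, j ≤ i → i < n → v i ≠ none

/-- Decrease the flow by `ε` on the forward arcs of the cycle and increase it by `ε` on its backward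
arcs. -/
def augment (y : Option V → Option V → ℝ) (v : ℕ → Option V) (fwd : ℕ → Prop) (j n : ℕ)
    (ε : ℝ) : Option V → Option V → ℝ := fun p q =>
  if ∃ i, j ≤ i ∧ i < n ∧ fwd i ∧ p = v i ∧ q = v (i + 1) then y p q - ε
  else if ∃ i, j ≤ i ∧ i < n ∧ ¬ fwd i ∧ p = v (i + 1) ∧ q = v i then y p q + ε
  else y p q

/-- The values whose minimum is the augmentation amount: the flows on forward arcs of the cycle, and
the differences `d - y a` for backward arcs `a` of the cycle and (sub-)sinks at the head of `a`
with demand `d > y a`. -/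
def augmentBounds (σ : State b) (v : ℕ → Option V) (fwd : ℕ → Prop) (j n : ℕ) : Set ℝ :=
  {r | ∃ i, j ≤ i ∧ i < n ∧ fwd i ∧ r = σ.y (v i) (v (i + 1))} ∪
  {r | ∃ i, j ≤ i ∧ i < n ∧ ¬ fwd i ∧ ∃ τ, σ.loc τ = v i ∧
    σ.y (v (i + 1)) (v i) < σ.dem τ ∧ r = σ.dem τ - σ.y (v (i + 1)) (v i)}

/-- An iteration in which a nice alternating cycle is found: the flow is augmented along the cycle,
and then (sub-)sinks are moved by the DGG moving rules as long as possible. -/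
def CycleIteration (σ σ' : State b) : Prop :=
  ∃ (v : ℕ → Option V) (fwd : ℕ → Prop) (j n : ℕ) (ε : ℝ),
    IsNiceCycle σ.y v fwd j n ∧ IsLeast (augmentBounds σ v fwd j n) ε ∧
    RunToEnd (DGGMove (Singular σ.y)) { σ with y := augment σ.y v fwd j n ε } σ'

/-! ### Iterations with a singular digraph -/

/-- The vertices found by the backward search from `w` along singular arcs that ignores the arc
`a' = (u₀, w)`. -/
inductive BackReach (y : Option V → Option V → ℝ) (u₀ : Option V) (w : V) : Option V → Prop
  | root : BackReach y u₀ w (some w)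
  | back {u v : Option V} : BackReach y u₀ w v → Singular y u v → ¬ (u = u₀ ∧ v = some w) →
      BackReach y u₀ w u

/-- The junction vertex `w` is reached along the arc `a' = (u₀, w)`, and the backward search finds no
non-funnel vertex other than `s*`: its vertices are those of the singular digraph rooted at `w`. -/
def FindsSingularDigraph (y : Option V → Option V → ℝ) (u₀ : Option V) (w : V) : Prop :=
  0 < y u₀ (some w) ∧ Junction y (some w) ∧ ∀ v, BackReach y u₀ w v → v ≠ none → Funnel y v

/-- Route `min (dem τ) (y (s*, s))` units of the demand of `τ` backward along the path `l` (from the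
source `s` to the current vertex of `τ`) and the dummy arc `(s*, s)`.  If the dummy arc carries less
than the demand of `τ`, then `τ` is split and the rest of its demand stays at its current
vertex. -/
def feed (σ : State b) (τ : ↥(sinks b)) (s : V) (l : List V) : State b :=
  let δ := min (σ.dem τ) (σ.y none (some s))
  { y := fun p q => if [p, q] <:+: none :: l.map some then σ.y p q - δ else σ.y p q
    loc := if σ.dem τ ≤ σ.y none (some s) then Function.update σ.loc τ none else σ.loc
    dem := Function.update σ.dem τ (σ.dem τ - δ)
    trail := σ.trail
    out := ⟨l.dropLast ++ σ.trail τ, δ⟩ :: σ.out }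

/-- One step of the routing in the singular digraph with vertex set `R`, rooted at `w`, with
`a' = (u₀, w)` and the selected (sub-)sink `t` at `w`.  Start at a source `s` that is a leaf of the
remaining in-tree and follow outgoing arcs until a vertex with a (sub-)sink is encountered; choose a
(sub-)sink `τ` there, and choose `t` only if no other (sub-)sink is at `w`.  As `s` is a leaf, the
flow on the dummy arc `(s*, s)` equals the flow on the outgoing arc of `s` if no (sub-)sink is
at `s`; comparing the demand with the flow on the dummy arc also covers (sub-)sinks at `s`. -/
def FeedStep (R : Option V → Prop) (u₀ : Option V) (w : V) (t : ↥(sinks b))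
    (σ σ' : State b) : Prop :=
  ∃ (s : V) (l : List V) (τ : ↥(sinks b)) (z : V),
    R (some s) ∧ 0 < σ.y none (some s) ∧ ¬ (none = u₀ ∧ s = w) ∧
    (∀ u : V, 0 < σ.y (some u) (some s) → some u = u₀ ∧ s = w) ∧
    l.head? = some s ∧ l.getLast? = some z ∧
    l.IsChain (fun p q => 0 < σ.y (some p) (some q)) ∧
    (∀ p ∈ l.dropLast, ∀ τ', σ.loc τ' ≠ some p) ∧
    σ.loc τ = some z ∧
    (τ = t → ∀ τ', τ' ≠ t → σ.loc τ' ≠ some w) ∧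
    σ' = feed σ τ s l

/-- An iteration in which a singular digraph is found.  A (sub-)sink `t` at `w` with demand larger
than the flow on `a' = (u₀, w)` is selected.  The demands in the singular digraph are routed to the
super-source until no flow is left on its arcs and only (a sub-sink of) `t` is left at its vertices.
That sub-sink is moved along `a'`, and then (sub-)sinks are moved by the DGG moving rules as long as
possible. -/
def SingularIteration (σ σ' : State b) : Prop :=
  ∃ (u₀ : Option V) (w : V) (t : ↥(sinks b)) (σ₁ : State b),
    FindsSingularDigraph σ.y u₀ w ∧ σ.loc t = some w ∧ σ.y u₀ (some w) < σ.dem t ∧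
    Relation.ReflTransGen (FeedStep (BackReach σ.y u₀ w) u₀ w t) σ σ₁ ∧
    (∀ u v, BackReach σ.y u₀ w v → ¬ (u = u₀ ∧ v = some w) → σ₁.y u v = 0) ∧
    σ₁.loc t = some w ∧
    (∀ τ, τ ≠ t → ∀ v : V, σ₁.loc τ = some v → ¬ BackReach σ.y u₀ w (some v)) ∧
    RunToEnd (DGGMove (Singular σ.y)) (move σ₁ t u₀) σ'

/-! ### The algorithm -/

/-- An iteration of the main loop, which is entered while some (sub-)sink has not reached `s*`. -/
def Iteration (σ σ' : State b) : Prop :=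
  (∃ τ, σ.loc τ ≠ none) ∧ (CycleIteration σ σ' ∨ SingularIteration σ σ')

/-- `P` is an output of the Modified DGG Algorithm on the balance function `b` and
the `b`-transshipment `x`. -/
def IsOutput (b : V → ℝ) (x : V → V → ℝ) (P : List (PathFlow V)) : Prop :=
  ∃ σ₀ σ₁ : State b, RunToEnd PrelimStep (init b x) σ₀ ∧
    Relation.ReflTransGen Iteration σ₀ σ₁ ∧ (∀ τ, σ₁.loc τ = none) ∧ P = σ₁.out

end

end ModDGG

namespace ModDGG

open Classical

/-! ### Transfers that retire an endpoint

Every path that is output retires one of its endpoints: either the sink has no demand left, or the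
dummy arc of the source has no flow left.  A retired vertex is an endpoint of no later path. -/

/-! Every output path exhausts one of its endpoints. If a (sub-)sink is moved or fed to `s*` as a
whole, the sink has no demand left; if it is split, the routed part is exactly the flow of the dummy
arc, so the source has nothing left. An exhausted vertex is an endpoint of no later path, because a
path needs a dummy arc with positive flow and a sink that has not reached `s*`, and neither property
is ever regained.

Read from the latest path back to the earliest, each edge therefore attaches a vertex that is
isolated in the graph of the later edges. Such a graph is a forest (`isAcyclic_of_pairwise_avoids`).
The exhausted vertices are pairwise distinct, and the other endpoint of the last path is not among
them, which gives the bound with the extra one (`length_lt_of_pairwise_avoids`).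

What remains is an invariant that carries the list of paths with their exhausted endpoints
(`IsLedger`). Only dummy arcs, sink locations, positive demands and ends of trails matter for it, so
each operation needs just a local check. -/

/-- A source and a sink joined by an output path, with the endpoint that is retired by it. -/
structure Transfer (V : Type*) where
  source : V
  sink : V
  retired : V

/-- The endpoints of the transfer are a source and a sink, one of which is the retired vertex. -/
structure Transfer.Valid {V : Type*} (b : V → ℝ) (e : Transfer V) : Prop where
  source_mem : e.source ∈ sources b
  sink_mem : e.sink ∈ sinks b
  retired_eq : e.retired = e.source ∨ e.retired = e.sink

/-- The transfer `new` avoids the vertex retired by `old`. -/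
def Transfer.Avoids {V : Type*} (new old : Transfer V) : Prop :=
  old.retired ≠ new.source ∧ old.retired ≠ new.sink

/-- The path flow `p` starts and ends at the endpoints of the transfer. -/
def Transfer.Records {V : Type*} (p : PathFlow V) (e : Transfer V) : Prop :=
  p.vertices.head? = some e.source ∧ p.vertices.getLast? = some e.sink

/-! ### Forests and counting from successive retirement -/

section Combinatorics

variable {V : Type*} {b : V → ℝ}

theorem ne_of_mem_sources_of_mem_sinks {s t : V} (hs : s ∈ sources b) (ht : t ∈ sinks b) :
    s ≠ t := by
  rintro rfl
  exact lt_asymm (show 0 < b s from hs) ht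

/-- A graph all of whose edges come from a list of transfers, each of which avoids the vertices
retired by the transfers after it in the list, is acyclic. -/
theorem isAcyclic_of_pairwise_avoids (E : List (Transfer V)) (hv : ∀ e ∈ E, e.Valid b)
    (hE : E.Pairwise Transfer.Avoids) (G : SimpleGraph V)
    (hG : ∀ e ∈ G.edgeSet, ∃ a ∈ E, e = s(a.source, a.sink)) : G.IsAcyclic := by
  -- The list has the newest transfer first, so this peels off the oldest one, whose retired
  -- endpoint meets no other edge.
  induction E using List.reverseRecOn generalizing G with
  | nil =>
    have : G = ⊥ := by
      rw [← SimpleGraph.edgeSet_eq_empty, Set.eq_empty_iff_forall_notMem]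
      intro e he
      obtain ⟨a, ha, -⟩ := hG e he
      simp at ha
    rw [this]
    exact SimpleGraph.isAcyclic_bot
  | append_singleton E a ih =>
    rw [List.pairwise_append] at hE
    obtain ⟨hE, -, hav⟩ := hE
    have hva := hv a (by simp)
    set G' := G.deleteEdges {s(a.source, a.sink)} with hG'
    have hedge : ∀ e ∈ G'.edgeSet, ∃ c ∈ E, e = s(c.source, c.sink) := by
      intro e he
      rw [hG', SimpleGraph.edgeSet_deleteEdges] at he
      obtain ⟨c, hc, rfl⟩ := hG e he.1
      rcases List.mem_append.1 hc with hc | hc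
      · exact ⟨c, hc, rfl⟩
      · rw [List.mem_singleton] at hc
        exact absurd (by simp [hc]) he.2
    have hac : G'.IsAcyclic := ih (fun e he => hv e (by simp [he])) hE G' hedge
    have hiso : ∀ v, ¬ G'.Adj a.retired v := by
      intro v hadj
      obtain ⟨c, hc, hcv⟩ := hedge s(a.retired, v) hadj
      have := hav c hc a (by simp)
      have hmem : a.retired ∈ s(c.source, c.sink) := hcv ▸ Sym2.mem_mk_left _ _
      rcases Sym2.mem_iff.1 hmem with h | h
      · exact this.1 h
      · exact this.2 h
    have hreach : ∀ v, G'.Reachable a.retired v → a.retired = v := by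
      rintro v ⟨p⟩
      cases p with
      | nil => rfl
      | cons h _ => exact absurd h (hiso _)
    have hne := ne_of_mem_sources_of_mem_sinks hva.source_mem hva.sink_mem
    have hnr : ¬ G'.Reachable a.source a.sink := by
      rcases hva.retired_eq with h | h
      · intro hr
        exact hne (h ▸ hreach _ (h ▸ hr))
      · intro hr
        exact hne (h ▸ (hreach _ (h ▸ hr.symm))).symm
    -- Since one endpoint is isolated in `G'`, restoring the edge joins two components and closes no
    -- cycle.
    refine (hac.sup_edge_of_not_reachable hnr).anti ?_
    intro u v huv
    by_cases h : s(u, v) = s(a.source, a.sink)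
    · right
      rw [SimpleGraph.edge_adj]
      exact ⟨by simpa using h, huv.ne⟩
    · left
      rw [hG', SimpleGraph.deleteEdges_adj]
      exact ⟨huv, h⟩

/-- The number of transfers is less than the number of sources and sinks. -/
theorem length_lt_of_pairwise_avoids [Finite V] (E : List (Transfer V))
    (hv : ∀ e ∈ E, e.Valid b) (hE : E.Pairwise Transfer.Avoids) (hb : b ≠ 0) :
    E.length + 1 ≤ (sources b).ncard + (sinks b).ncard := by
  refine le_trans ?_ (Set.ncard_union_le _ _)
  cases E with
  | nil =>
    obtain ⟨v, hbv⟩ := Function.ne_iff.1 hb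
    have : (sources b ∪ sinks b).Nonempty := by
      rcases lt_or_gt_of_ne hbv with h | h
      · exact ⟨v, Or.inr h⟩
      · exact ⟨v, Or.inl h⟩
    exact (Set.ncard_pos).2 this
  | cons e E =>
    have hmem : ∀ c ∈ e :: E, c.retired ∈ sources b ∪ sinks b := by
      intro c hc
      rcases (hv c hc).retired_eq with h | h
      · exact Or.inl (h ▸ (hv c hc).source_mem)
      · exact Or.inr (h ▸ (hv c hc).sink_mem)
    have hnd : ((e :: E).map Transfer.retired).Nodup := by
      rw [List.Nodup, List.pairwise_map]
      refine hE.imp_of_mem ?_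
      intro c d hc _ hcd heq
      rcases (hv c hc).retired_eq with h | h
      · exact hcd.1 (heq ▸ h)
      · exact hcd.2 (heq ▸ h)
    -- The extra vertex is the endpoint of the newest transfer that this transfer does not retire:
    -- older transfers cannot have retired it either.
    obtain ⟨o, ho, hoE⟩ : ∃ o ∈ sources b ∪ sinks b, o ∉ (e :: E).map Transfer.retired := by
      have hve := hv e (by simp)
      have hne := ne_of_mem_sources_of_mem_sinks hve.source_mem hve.sink_mem
      have hav := (List.pairwise_cons.1 hE).1
      rcases hve.retired_eq with h | h
      · refine ⟨e.sink, Or.inr hve.sink_mem, ?_⟩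
        simp only [List.map_cons, List.mem_cons, List.mem_map, not_or, not_exists, not_and]
        exact ⟨h ▸ hne.symm, fun c hc => (hav c hc).2⟩
      · refine ⟨e.source, Or.inl hve.source_mem, ?_⟩
        simp only [List.map_cons, List.mem_cons, List.mem_map, not_or, not_exists, not_and]
        exact ⟨h ▸ hne, fun c hc => (hav c hc).1⟩
    have hnd' : (o :: (e :: E).map Transfer.retired).Nodup := List.nodup_cons.2 ⟨hoE, hnd⟩
    have hcard := List.toFinset_card_of_nodup hnd'
    rw [← Set.ncard_coe_finset] at hcard
    simp only [List.length_cons, List.length_map] at hcard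
    rw [List.length_cons, ← hcard]
    refine Set.ncard_le_ncard ?_
    intro v hvm
    simp only [List.coe_toFinset, Set.mem_ofPred_eq] at hvm
    rcases List.mem_cons.1 hvm with rfl | hvm
    · exact ho
    · obtain ⟨c, hc, rfl⟩ := List.mem_map.1 hvm
      exact hmem c hc

end Combinatorics

/-! ### The invariant of the algorithm -/

section Invariant

variable {V : Type*} {b : V → ℝ}

/-- The vertex `k` is an endpoint of no path that is output from now on. -/
def Retired (σ : State b) (k : V) : Prop :=
  (k ∈ sources b → σ.y none (some k) ≤ 0) ∧ ∀ τ : ↥(sinks b), (τ : V) = k → σ.loc τ = none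

/-- A list of transfers records the output of `σ`, the most recent one first. -/
structure IsLedger (σ : State b) (E : List (Transfer V)) : Prop where
  records : List.Forall₂ Transfer.Records σ.out E
  valid : ∀ e ∈ E, e.Valid b
  avoids : E.Pairwise Transfer.Avoids
  retired : ∀ e ∈ E, Retired σ e.retired

/-- The invariant of the algorithm. -/
structure Invariant (σ : State b) : Prop where
  dem_pos : ∀ τ, σ.loc τ ≠ none → 0 < σ.dem τ
  trail_head : ∀ τ v, σ.loc τ = some v → (σ.trail τ).head? = some v
  trail_last : ∀ τ, (σ.trail τ).getLast? = some (τ : V)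
  source_of_pos : ∀ s, 0 < σ.y none (some s) → s ∈ sources b
  ledger : ∃ E, IsLedger σ E

/-- From `σ` to `σ'`, no flow is added to the dummy arcs and no finished sink is reopened. -/
structure Progress (σ σ' : State b) : Prop where
  dummy_le : ∀ s, σ'.y none (some s) ≤ σ.y none (some s)
  loc_none : ∀ τ, σ.loc τ = none → σ'.loc τ = none

/-- Retirement is permanent: an upper bound on dummy flow survives decreases, and finished sinks
stay finished. -/
theorem Progress.retired {σ σ' : State b} (h : Progress σ σ') {k : V} (hk : Retired σ k) :
    Retired σ' k :=
  ⟨fun hs => (h.dummy_le k).trans (hk.1 hs), fun τ hτ => h.loc_none τ (hk.2 τ hτ)⟩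

theorem Progress.exists_ledger {σ σ' : State b} (h : Progress σ σ') (hout : σ'.out = σ.out)
    (hL : ∃ E, IsLedger σ E) : ∃ E, IsLedger σ' E := by
  obtain ⟨E, hE⟩ := hL
  exact ⟨E, hout ▸ hE.records, hE.valid, hE.avoids, fun e he => h.retired (hE.retired e he)⟩

/-- Before the step the source still has dummy flow and the sink is unfinished, so neither was
retired by an older transfer; `hret` supplies the endpoint that the new transfer retires. -/
theorem Progress.exists_ledger_cons {σ σ' : State b} (h : Progress σ σ') {p : PathFlow V}
    {s : V} {τ : ↥(sinks b)} (hout : σ'.out = p :: σ.out) (hhead : p.vertices.head? = some s)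
    (hlast : p.vertices.getLast? = some (τ : V)) (hs : s ∈ sources b)
    (hpos : 0 < σ.y none (some s)) (hτ : σ.loc τ ≠ none)
    (hret : σ'.y none (some s) ≤ 0 ∨ σ'.loc τ = none) (hL : ∃ E, IsLedger σ E) :
    ∃ E, IsLedger σ' E := by
  obtain ⟨E, hE⟩ := hL
  have hne := ne_of_mem_sources_of_mem_sinks hs τ.2
  obtain ⟨k, hk, hkr⟩ : ∃ k, (k = s ∨ k = τ) ∧ Retired σ' k := by
    rcases hret with hy | hl
    -- Sources and sinks are disjoint, so only one clause of `Retired` has content in each case.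
    · exact ⟨s, Or.inl rfl, fun _ => hy, fun τ' hτ' =>
        absurd hτ'.symm (ne_of_mem_sources_of_mem_sinks hs τ'.2)⟩
    · refine ⟨τ, Or.inr rfl, fun hm => ?_, fun τ' hτ' => ?_⟩
      · exact absurd rfl (ne_of_mem_sources_of_mem_sinks hm τ.2)
      · rwa [Subtype.ext hτ']
  refine ⟨⟨s, τ, k⟩ :: E, ?_, ?_, ?_, ?_⟩
  · rw [hout]
    exact List.Forall₂.cons ⟨hhead, hlast⟩ hE.records
  · rintro e he
    rcases List.mem_cons.1 he with rfl | he
    · exact ⟨hs, τ.2, hk⟩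
    · exact hE.valid e he
  · refine List.pairwise_cons.2 ⟨fun e he => ⟨?_, ?_⟩, hE.avoids⟩
    · intro heq
      have heq : e.retired = s := heq
      have := (hE.retired e he).1
      rw [heq] at this
      exact not_lt.2 (this hs) hpos
    · intro heq
      exact hτ ((hE.retired e he).2 τ heq.symm)
  · intro e he
    rcases List.mem_cons.1 he with rfl | he
    · exact hkr
    · exact h.retired (hE.retired e he)

/-! ### Preservation under the elementary changes of state -/

theorem Invariant.init (x : V → V → ℝ) : Invariant (init b x) where
  dem_pos τ _ := abs_pos.2 (ne_of_lt τ.2)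
  trail_head τ v h := by
    have h : some (τ : V) = some v := h
    simpa [ModDGG.init] using h
  trail_last τ := by simp [ModDGG.init]
  source_of_pos s h := by
    by_contra hs
    simp [ModDGG.init, initFlow, hs] at h
  ledger := ⟨[], List.Forall₂.nil, by simp, List.Pairwise.nil, by simp⟩

/-- A move to `s*` takes all remaining demand, so it retires the sink. Positivity of the dummy arc
is enough to identify the source; no comparison of its flow with the demand is needed. -/
theorem Invariant.move {σ : State b} (hσ : Invariant σ) {τ : ↥(sinks b)} {v : V}
    {u : Option V} (hτ : σ.loc τ = some v) (hu : u = none → 0 < σ.y none (some v)) :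
    Invariant (move σ τ u) := by
  have hd : 0 < σ.dem τ := hσ.dem_pos τ (by simp [hτ])
  have hprog : Progress σ (ModDGG.move σ τ u) := by
    refine ⟨fun s => ?_, fun τ' h' => ?_⟩
    · simp only [ModDGG.move]
      split_ifs <;> linarith
    · have : τ' ≠ τ := by
        rintro rfl
        simp [hτ] at h'
      simp [ModDGG.move, this, h']
  refine ⟨fun τ' h' => ?_, fun τ' v' h' => ?_, fun τ' => ?_, fun s hs => ?_, ?_⟩
  · exact hσ.dem_pos τ' (fun h => h' (hprog.loc_none τ' h))
  · by_cases hc : τ' = τ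
    · subst hc
      simp only [ModDGG.move, Function.update_self] at h'
      subst h'
      simp [ModDGG.move]
    · have hl : σ.loc τ' = some v' := by simpa [ModDGG.move, hc] using h'
      cases u <;> simpa [ModDGG.move, hc] using hσ.trail_head τ' v' hl
  · cases u with
    | none => exact hσ.trail_last τ'
    | some u =>
      by_cases hc : τ' = τ
      · subst hc
        simp [ModDGG.move, List.getLast?_cons, hσ.trail_last τ']
      · simpa [ModDGG.move, hc] using hσ.trail_last τ'
  · exact hσ.source_of_pos s (hs.trans_le (hprog.dummy_le s))
  · cases u with
    | some u => exact hprog.exists_ledger rfl hσ.ledger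
    | none =>
      have hpos := hu rfl
      exact hprog.exists_ledger_cons (p := ⟨σ.trail τ, σ.dem τ⟩) rfl (hσ.trail_head τ v hτ)
        (hσ.trail_last τ) (hσ.source_of_pos v hpos) hpos (by simp [hτ])
        (Or.inr (by simp [ModDGG.move])) hσ.ledger

/-- The amount is the minimum of the demand and the dummy flow; the one attaining it decides whether
the sink or the source is retired. -/
theorem Invariant.feed {σ : State b} (hσ : Invariant σ) {τ : ↥(sinks b)} {s z : V}
    {l : List V} (hs : 0 < σ.y none (some s)) (hhead : l.head? = some s)
    (hlast : l.getLast? = some z) (hτ : σ.loc τ = some z) : Invariant (feed σ τ s l) := by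
  have hd : 0 < σ.dem τ := hσ.dem_pos τ (by simp [hτ])
  have hδ : 0 < min (σ.dem τ) (σ.y none (some s)) := lt_min hd hs
  obtain ⟨l', rfl⟩ : ∃ l', l = s :: l' := by
    cases l with
    | nil => simp at hhead
    | cons a l' =>
      simp only [List.head?_cons, Option.some.injEq] at hhead
      exact ⟨l', by rw [hhead]⟩
  have hys : (ModDGG.feed σ τ s (s :: l')).y none (some s)
      = σ.y none (some s) - min (σ.dem τ) (σ.y none (some s)) :=
    if_pos ⟨[], l'.map some, rfl⟩
  have hprog : Progress σ (ModDGG.feed σ τ s (s :: l')) := by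
    refine ⟨fun s' => ?_, fun τ' h' => ?_⟩
    · simp only [ModDGG.feed]
      split_ifs <;> linarith
    · have : τ' ≠ τ := by
        rintro rfl
        simp [hτ] at h'
      simp only [ModDGG.feed]
      split_ifs <;> simp [this, h']
  refine ⟨fun τ' h' => ?_, fun τ' v' h' => ?_, hσ.trail_last, fun s hs => ?_, ?_⟩
  · by_cases hc : τ' = τ
    · subst hc
      simp only [ModDGG.feed, Function.update_self] at h' ⊢
      split_ifs at h' with hle
      · simp at h'
      · rw [min_eq_right (not_le.1 hle).le]
        linarith
    · simpa [ModDGG.feed, hc] using hσ.dem_pos τ' (fun h => h' (hprog.loc_none τ' h))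
  · refine hσ.trail_head τ' v' ?_
    simp only [ModDGG.feed] at h'
    split_ifs at h' with hle
    · by_cases hc : τ' = τ
      · simp [hc] at h'
      · simpa [hc] using h'
    · exact h'
  · exact hσ.source_of_pos s (hs.trans_le (hprog.dummy_le s))
  · refine hprog.exists_ledger_cons (τ := τ) (p := ⟨(s :: l').dropLast ++ σ.trail τ, _⟩) rfl ?_ ?_
      (hσ.source_of_pos s hs) hs (by simp [hτ]) ?_ hσ.ledger
    -- If `l` is the single vertex `s`, then `l.dropLast` is empty and the start of the path comes
    -- from the trail, which begins at `z = s`.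
    · cases l' with
      | nil =>
        have : s = z := by simpa using hlast
        simpa [this] using hσ.trail_head τ z hτ
      | cons a l' => simp
    · simp [List.getLast?_append, hσ.trail_last τ]
    · rcases le_or_gt (σ.dem τ) (σ.y none (some s)) with hle | hgt
      · right
        simp [ModDGG.feed, hle]
      · left
        rw [hys, min_eq_right hgt.le, sub_self]

/-- A nice cycle avoids `s*`, so no dummy arc can be one of the backward arcs that gain flow. -/
theorem Invariant.augment {σ : State b} (hσ : Invariant σ) {v : ℕ → Option V}
    {fwd : ℕ → Prop} {j n : ℕ} {ε : ℝ} (hc : IsNiceCycle σ.y v fwd j n) (hε : 0 ≤ ε) :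
    Invariant { σ with y := augment σ.y v fwd j n ε } := by
  have hnone : ∀ i, j ≤ i → i ≤ n → v i ≠ none := by
    intro i hj hn
    rcases hn.lt_or_eq with h | rfl
    · exact hc.nice i hj h
    · rw [hc.closed]
      exact hc.nice j le_rfl hc.lt
  have hprog : Progress σ { σ with y := ModDGG.augment σ.y v fwd j n ε } := by
    refine ⟨fun s => ?_, fun _ h => h⟩
    simp only [ModDGG.augment]
    split_ifs with h1 h2
    · linarith
    · obtain ⟨i, hj, hn, -, h, -⟩ := h2
      exact absurd h.symm (hnone (i + 1) (by omega) hn)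
    · exact le_rfl
  exact ⟨hσ.dem_pos, hσ.trail_head, hσ.trail_last,
    fun s hs => hσ.source_of_pos s (hs.trans_le (hprog.dummy_le s)),
    hprog.exists_ledger rfl hσ.ledger⟩

theorem augmentBounds_pos {σ : State b} {v : ℕ → Option V} {fwd : ℕ → Prop} {j n : ℕ}
    (hc : IsNiceCycle σ.y v fwd j n) {r : ℝ} (hr : r ∈ augmentBounds σ v fwd j n) : 0 < r := by
  rcases hr with ⟨i, -, hn, hf, rfl⟩ | ⟨i, -, -, -, τ, -, hlt, rfl⟩
  · exact hc.walk.forward i hn hf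
  · exact sub_pos.2 hlt

/-- Routing in the singular digraph does not change the flow on `a'` if `a'` is a dummy arc. -/
theorem feed_dummy_eq_of_ne {σ : State b} {τ : ↥(sinks b)} {s w : V} {l : List V}
    (hhead : l.head? = some s) (hne : s ≠ w) :
    (feed σ τ s l).y none (some w) = σ.y none (some w) := by
  refine if_neg fun h => ?_
  -- `none` occurs only at the front of the routed path, so the only dummy arc on it is the one into
  -- `s`.
  rcases List.infix_cons_iff.1 h with h | h
  · cases l with
    | nil => simp at hhead
    | cons a l =>
      have ha : a = s := by simpa using hhead
      simp only [List.map_cons, List.cons_prefix_cons, Option.some.injEq] at h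
      exact hne (ha ▸ h.2.1.symm)
  · have : (none : Option V) ∈ l.map some := h.subset (by simp)
    simp at this

theorem _root_.Relation.ReflTransGen.preserves {α : Type*} {R : α → α → Prop} {p : α → Prop}
    (h : ∀ a a', R a a' → p a → p a') {a a' : α} (hR : Relation.ReflTransGen R a a')
    (ha : p a) : p a' := by
  induction hR with
  | refl => exact ha
  | tail _ hs ih => exact h _ _ hs ih

/-! ### Preservation under the steps and iterations of the algorithm -/

theorem Invariant.prelimStep {σ σ' : State b} (h : PrelimStep σ σ') (hσ : Invariant σ) :
    Invariant σ' := by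
  obtain ⟨τ, v, u, hτ, hpos, -, rfl⟩ := h
  exact hσ.move hτ (fun hu => hu ▸ hpos)

theorem Invariant.dggMove {sing : Option V → Option V → Prop} {σ σ' : State b}
    (h : DGGMove sing σ σ') (hσ : Invariant σ) : Invariant σ' := by
  obtain ⟨τ, v, u, hτ, hpos, -, rfl⟩ := h
  exact hσ.move hτ (fun hu => hu ▸ hpos)

theorem Invariant.feedStep {R : Option V → Prop} {u₀ : Option V} {w : V} {t : ↥(sinks b)}
    {σ σ' : State b} (h : FeedStep R u₀ w t σ σ') (hσ : Invariant σ) : Invariant σ' := by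
  obtain ⟨s, l, τ, z, -, hs, -, -, hhead, hlast, -, -, hτ, -, rfl⟩ := h
  exact hσ.feed hs hhead hlast hτ

theorem Invariant.cycleIteration {σ σ' : State b} (h : CycleIteration σ σ')
    (hσ : Invariant σ) : Invariant σ' := by
  obtain ⟨v, fwd, j, n, ε, hc, hε, hrun⟩ := h
  exact hrun.1.preserves (p := Invariant) (fun _ _ => Invariant.dggMove)
    (hσ.augment hc (augmentBounds_pos hc hε.1).le)

theorem Invariant.singularIteration {σ σ' : State b} (h : SingularIteration σ σ')
    (hσ : Invariant σ) : Invariant σ' := by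
  obtain ⟨u₀, w, t, σ₁, hfind, -, -, hfeed, -, ht, -, hrun⟩ := h
  refine hrun.1.preserves (p := Invariant) (fun _ _ => Invariant.dggMove) ?_
  refine (hfeed.preserves (p := Invariant) (fun _ _ => Invariant.feedStep) hσ).move ht ?_
  -- If `a'` is itself a dummy arc, its flow must still be positive when `t` is moved. It is
  -- positive initially, and feeding never starts at `w` in this case, so it stays unchanged.
  rintro rfl
  refine hfeed.preserves (p := fun ρ => 0 < ρ.y none (some w)) ?_ hfind.1
  rintro ρ _ ⟨s, l, τ, z, -, -, hne, -, hhead, -, -, -, -, -, rfl⟩ hpos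
  rwa [feed_dummy_eq_of_ne hhead (fun h => hne ⟨rfl, h⟩)]

theorem Invariant.iteration {σ σ' : State b} (h : Iteration σ σ') (hσ : Invariant σ) :
    Invariant σ' :=
  h.2.elim (fun h => hσ.cycleIteration h) (fun h => hσ.singularIteration h)

/-! ### From the invariant to the bipartite graph -/

/-- Every output of the algorithm is recorded by a list of transfers, each of which avoids the
vertices retired by the transfers after it in the list. -/
theorem IsOutput.exists_transfers {x : V → V → ℝ} {P : List (PathFlow V)}
    (h : IsOutput b x P) : ∃ E : List (Transfer V), List.Forall₂ Transfer.Records P E ∧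
      (∀ e ∈ E, e.Valid b) ∧ E.Pairwise Transfer.Avoids := by
  obtain ⟨σ₀, σ₁, hpre, hit, -, rfl⟩ := h
  have h₀ : Invariant σ₀ :=
    hpre.1.preserves (p := Invariant) (fun _ _ => Invariant.prelimStep) (Invariant.init x)
  have h₁ : Invariant σ₁ := hit.preserves (p := Invariant) (fun _ _ => Invariant.iteration) h₀
  obtain ⟨E, hE⟩ := h₁.ledger
  exact ⟨E, hE.records, hE.valid, hE.avoids⟩

/-- The edges of the bipartite graph come from the transfers that record the output. -/
theorem exists_transfer_of_adj {P : List (PathFlow V)} {E : List (Transfer V)}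
    (hE : List.Forall₂ Transfer.Records P E) {u v : ↥(sources b ∪ sinks b)}
    (h : (bipartiteGraph b P).Adj u v) :
    ∃ e ∈ E, s((u : V), (v : V)) = s(e.source, e.sink) := by
  have key : ∀ s t : V, RoutesFlow P s t → ∃ e ∈ E, e.source = s ∧ e.sink = t := by
    rintro s t ⟨p, hp, -, hhead, hlast⟩
    obtain ⟨i, hi, rfl⟩ := List.mem_iff_getElem.1 hp
    have hi' : i < E.length := hE.length_eq ▸ hi
    have hrec : Transfer.Records P[i] E[i] := (List.forall₂_iff_get.1 hE).2 i hi hi'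
    exact ⟨E[i], List.getElem_mem hi', Option.some.inj (hrec.1.symm.trans hhead),
      Option.some.inj (hrec.2.symm.trans hlast)⟩
  rw [bipartiteGraph, SimpleGraph.fromRel_adj] at h
  rcases h.2 with ⟨-, -, h⟩ | ⟨-, -, h⟩
  · obtain ⟨e, he, h1, h2⟩ := key _ _ h
    exact ⟨e, he, by rw [h1, h2]⟩
  · obtain ⟨e, he, h1, h2⟩ := key _ _ h
    exact ⟨e, he, by rw [h1, h2, Sym2.eq_swap]⟩

/-- Transfers have endpoints in `V`, so the graph is pushed forward along the inclusion of the
sources and sinks; acyclicity of the image implies acyclicity of the graph. -/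
theorem bipartiteGraph_isAcyclic {P : List (PathFlow V)} {E : List (Transfer V)}
    (hrec : List.Forall₂ Transfer.Records P E) (hv : ∀ e ∈ E, e.Valid b)
    (hE : E.Pairwise Transfer.Avoids) : (bipartiteGraph b P).IsAcyclic := by
  refine SimpleGraph.IsAcyclic.of_map (Function.Embedding.subtype _) ?_
  refine isAcyclic_of_pairwise_avoids E hv hE _ ?_
  rw [Sym2.forall]
  rintro _ _ ⟨-, u, v, huv, rfl, rfl⟩
  exact exists_transfer_of_adj hrec huv

theorem ncard_edgeSet_bipartiteGraph_le {P : List (PathFlow V)} {E : List (Transfer V)}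
    (hrec : List.Forall₂ Transfer.Records P E) :
    (bipartiteGraph b P).edgeSet.ncard ≤ E.length := by
  have hinj : Function.Injective (Sym2.map (Subtype.val : ↥(sources b ∪ sinks b) → V)) :=
    Sym2.map.injective Subtype.val_injective
  rw [← Set.ncard_image_of_injective _ hinj]
  let F := E.map fun e => s(e.source, e.sink)
  calc _ ≤ (F.toFinset : Set (Sym2 V)).ncard := by
        refine Set.ncard_le_ncard ?_ (Finset.finite_toSet _)
        rintro _ ⟨e, he, rfl⟩
        induction e using Sym2.ind with
        | _ u v =>
          obtain ⟨e, he, h⟩ := exists_transfer_of_adj hrec he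
          simp only [List.coe_toFinset, Set.mem_ofPred_eq, Sym2.map_mk, F, List.mem_map]
          exact ⟨e, he, h.symm⟩
    _ ≤ F.length := by
        rw [Set.ncard_coe_finset]
        exact List.toFinset_card_le F
    _ = E.length := List.length_map _

end Invariant

end ModDGG

theorem mainTheorem3 {V : Type*} [Fintype V] (D : Digraph V) (hD : ModDGG.DigraphAcyclic D)
    (b : V → ℝ) (x : V → V → ℝ) (hx : ModDGG.IsTransshipment D b x)
    (P : List (ModDGG.PathFlow V)) (hP : ModDGG.IsOutput b x P) :
    (ModDGG.bipartiteGraph b P).IsAcyclic ∧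
    (b ≠ 0 →
      (ModDGG.bipartiteGraph b P).edgeSet.ncard + 1 ≤
          (ModDGG.sources b).ncard + (ModDGG.sinks b).ncard ∧
      P.length + 1 ≤ (ModDGG.sources b).ncard + (ModDGG.sinks b).ncard) := by
  obtain ⟨E, hrec, hv, hE⟩ := hP.exists_transfers
  refine ⟨ModDGG.bipartiteGraph_isAcyclic hrec hv hE, fun hb => ?_⟩
  have hlen := ModDGG.length_lt_of_pairwise_avoids E hv hE hb
  refine ⟨?_, hrec.length_eq ▸ hlen⟩
  exact (Nat.add_le_add_right (ModDGG.ncard_edgeSet_bipartiteGraph_le hrec) 1).trans hlen
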